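/- Let $\Omega\subset\mathbb{R}^{D}$ be a bounded connected open set whose boundary has finite $(D-1)$-dimensional Hausdorff measure and is of class $C^1$ outside a set of $(D-1)$-dimensional measure zero (e.g. a bounded $C^1$ domain or a box). Let $\mathbf{n}$ be the outward unit normal; boundary conditions involving $\mathbf n$ or tangent vectors $\boldsymbol\tau$ are understood at the points where $\partial\Omega$ is $C^1$. Let $\nu>0$, $\lambda\ge 0$, a time step $k>0$, an initial time $t_0$, a body force $\mathbf g$, and an $s$-stage Runge--Kutta method $(A,\mathbf b,\mathbf c)$ be given, and put $t^n=t_0+nk$, $\mathbf g^{(i)}=\mathbf g(\cdot,t^n+c_ik)$, $I_{cv}(\mathbf v,\mathbf u)=\int_\Omega(\mathbf v\cdot\nabla\mathbf v)\cdot\mathbf u\,\mathrm dV$. We write $\mathbf u=\mathscr P\mathbf v$, where $\mathscr P$ is the Leray--Helmholtz projection, if $\mathbf u=\mathbf v-\nabla\phi$ in $\Omega$ for a scalar $\phi\in C^2(\overline\Omega)$, $\nabla\cdot\mathbf u=0$ in $\Omega$, and $\mathbf n\cdot\mathbf u=0$ on $\partial\Omega$. A (classical) run of the GePUP-ES-RK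 scheme consists, for each $n\in\mathbb N$, of step values $\mathbf w^n,\mathbf u^n,r^n$ and of stage values $\mathbf w^{(i)},\mathbf u^{(i)},q^{(i)},r^{(i)}$ ($i=1,\dots,s$; they belong to the step from $t^n$ to $t^{n+1}$) and auxiliary velocities $\widetilde{\mathbf u}^{(i)}$ (arbitrary fields), with $\mathbf w^n,\mathbf g^{(i)}\in C^1(\overline\Omega)$, $\mathbf w^{(i)}\in C^3(\overline\Omega)$, $q^{(i)},\widetilde{\mathbf u}^{(i)}\in C^2(\overline\Omega)$, such that, with $$\boldsymbol\rho^{(i)}=\mathbf g^{(i)}-r^{(i)}\widetilde{\mathbf u}^{(i)}\cdot\nabla\widetilde{\mathbf u}^{(i)}-\nabla q^{(i)}+\nu\Delta\mathbf w^{(i)},$$ one has $$\mathbf w^{n+1}=\mathbf w^n+k\sum_i b_i\boldsymbol\rho^{(i)}\ \text{in }\Omega,\qquad r^{n+1}=r^n+k\sum_i b_iI_{cv}(\widetilde{\mathbf u}^{(i)},\mathbf u^{(i)}),\qquad \mathbf u^{n+1}=\mathscr P\mathbf w^{n+1},$$ and, for $i=1,\dots,s$, $$\Delta q^{(i)}=\nabla\cdot\bigl(\mathbf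 g^{(i)}-r^{(i)}\widetilde{\mathbf u}^{(i)}\cdot\nabla\widetilde{\mathbf u}^{(i)}\bigr)\ \text{in }\Omega,\qquad \mathbf n\cdot\nabla q^{(i)}=\mathbf n\cdot\bigl(\mathbf g^{(i)}-r^{(i)}\widetilde{\mathbf u}^{(i)}\cdot\nabla\widetilde{\mathbf u}^{(i)}+\nu\Delta\mathbf w^{(i)}\bigr)+\lambda\,\mathbf n\cdot\mathbf w^{(i)}\ \text{on }\partial\Omega,$$ $$\mathbf w^{(i)}=\mathbf w^n+k\sum_j a_{i,j}\boldsymbol\rho^{(j)}\ \text{in }\Omega,\qquad \mathbf w^{(i)}\cdot\boldsymbol\tau=0,\ \ \nabla\cdot\mathbf w^{(i)}=0\ \text{on }\partial\Omega,$$ $$r^{(i)}=r^n+k\sum_j a_{i,j}I_{cv}(\widetilde{\mathbf u}^{(j)},\mathbf u^{(j)}),\qquad \mathbf u^{(i)}=\mathscr P\mathbf w^{(i)}.$$ Suppose that the Runge--Kutta method is algebraically stable: $b_i\ge0$ for all $i$, and the matrix $m_{i,j}=b_ia_{i,j}+b_ja_{j,i}-b_ib_j$ is positive semidefinite. Suppose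 also that the initial velocity $\mathbf u^0$ satisfies $\nabla\cdot\mathbf u^0=0$ in $\Omega$ and $\mathbf n\cdot\mathbf u^0=0$ on $\partial\Omega$, and that $\mathbf w^0=\mathbf u^0$. Then: 1. for every $n\in\mathbb N$, $\|\nabla\cdot\mathbf w^n\|_{L^2(\Omega)}=0$, indeed $\nabla\cdot\mathbf w^n=0$ everywhere in $\Omega$, and $\mathbf n\cdot\mathbf w^n=0$ on $\partial\Omega$; 2. in every step $n\in\mathbb N$ and for every stage $i$ with positive weight $b_i>0$ (hence for all stages if all weights are positive), $\nabla\cdot\mathbf w^{(i)}=0$ in $\Omega$ and $\mathbf n\cdot\mathbf w^{(i)}=0$ on $\partial\Omega$. -/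

import Mathlib

open Filter Topology MeasureTheory
open scoped RealInnerProductSpace Gradient

namespace GePUP

/-- Points and vectors of `ℝ^D`, with the Euclidean norm. -/
abbrev Vec (D : ℕ) : Type := EuclideanSpace ℝ (Fin D)

/-! ### Domains and boundary values -/

/-- `n` is the outward unit normal of `Ω` at the boundary point `x`, and `∂Ω` is of class `C¹` near
`x`: in a neighbourhood `O` of `x` the set `Ω` is the sublevel set `{ψ < 0}` of a `C¹` function
whose gradient at `x` is a positive multiple of `n`. -/
def IsOutwardNormal {D : ℕ} (Ω : Set (Vec D)) (x n : Vec D) : Prop :=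
  x ∈ frontier Ω ∧ ‖n‖ = 1 ∧
    ∃ (O : Set (Vec D)) (ψ : Vec D → ℝ), IsOpen O ∧ x ∈ O ∧ ContDiffOn ℝ 1 ψ O ∧ ψ x = 0 ∧
      (∃ a : ℝ, 0 < a ∧ gradient ψ x = a • n) ∧ ∀ y ∈ O, (y ∈ Ω ↔ ψ y < 0)

/-- A bounded connected open set with piecewise `C¹` boundary: `∂Ω` has finite
`(D - 1)`-dimensional measure, and apart from a null set (corners, edges) it is of class `C¹`.
Every bounded domain with `C¹` boundary and every box is of this kind. -/
structure IsFlowDomain {D : ℕ} (Ω : Set (Vec D)) : Prop where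
  isOpen : IsOpen Ω
  isConnected : IsConnected Ω
  isBounded : Bornology.IsBounded Ω
  boundary_finite : μH[(D : ℝ) - 1] (frontier Ω) < ⊤
  boundary_regular : μH[(D : ℝ) - 1] {x ∈ frontier Ω | ¬ ∃ n, IsOutwardNormal Ω x n} = 0

/-- `f ∈ C^k(Ω̄)`: `f` is `C^k` in the open set `Ω`, and all its derivatives of order at most `k`
extend continuously to the closure. Only the values of `f` in `Ω` matter. -/
def IsCk {D : ℕ} {F : Type*} [NormedAddCommGroup F] [NormedSpace ℝ F]
    (k : ℕ) (Ω : Set (Vec D)) (f : Vec D → F) : Prop :=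
  ContDiffOn ℝ k f Ω ∧ ∀ m ≤ k, ∃ G : Vec D → ContinuousMultilinearMap ℝ (fun _ : Fin m => Vec D) F,
    ContinuousOn G (closure Ω) ∧ ∀ x ∈ Ω, G x = iteratedFDeriv ℝ m f x

/-- The value at `x ∈ ∂Ω` of a field given in `Ω` that extends continuously to the closure: its
limit at `x` from within `Ω`. -/
noncomputable def bdryVal {D : ℕ} {F : Type*} [TopologicalSpace F]
    (Ω : Set (Vec D)) (f : Vec D → F) (x : Vec D) : F :=
  extendFrom Ω f x

/-! ### Differential operators (the gradient and the Laplacian are Mathlib's) -/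

/-- The divergence `∇·v = ∑ⱼ ∂vⱼ/∂xⱼ`. -/
noncomputable def divg {D : ℕ} (v : Vec D → Vec D) (x : Vec D) : ℝ :=
  ∑ j : Fin D, (fderiv ℝ v x (EuclideanSpace.single j 1)) j

/-- The convection term `v·∇v = ∑ⱼ vⱼ ∂v/∂xⱼ`. -/
noncomputable def conv {D : ℕ} (v : Vec D → Vec D) (x : Vec D) : Vec D :=
  fderiv ℝ v x (v x)

/-- `I_cv(v, u) = ∫_Ω (v·∇v)·u dV`. -/
noncomputable def Icv {D : ℕ} (Ω : Set (Vec D)) (v u : Vec D → Vec D) : ℝ :=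
  ∫ x in Ω, ⟪conv v x, u x⟫

/-- `v·n = 0` on `∂Ω`. -/
def HasZeroNormal {D : ℕ} (Ω : Set (Vec D)) (v : Vec D → Vec D) : Prop :=
  ∀ x n, IsOutwardNormal Ω x n → ⟪n, bdryVal Ω v x⟫ = 0

/-- `v·τ = 0` on `∂Ω` for every tangent vector `τ`. -/
def HasZeroTangential {D : ℕ} (Ω : Set (Vec D)) (v : Vec D → Vec D) : Prop :=
  ∀ x n, IsOutwardNormal Ω x n → ∀ τ : Vec D, ⟪τ, n⟫ = 0 → ⟪bdryVal Ω v x, τ⟫ = 0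

/-- `u = 𝒫 v` in `Ω` and `n·u = 0` on `∂Ω`, for the Leray-Helmholtz projection `𝒫`: `u` is the
divergence-free part, with zero normal component, in the Helmholtz decomposition
`v = u + ∇φ`. -/
def IsLerayProjection {D : ℕ} (Ω : Set (Vec D)) (v u : Vec D → Vec D) : Prop :=
  (∃ φ : Vec D → ℝ, IsCk 2 Ω φ ∧ ∀ x ∈ Ω, u x = v x - gradient φ x) ∧
    (∀ x ∈ Ω, divg u x = 0) ∧ HasZeroNormal Ω u

/-! ### Runge-Kutta methods -/

/-- The coefficients of an `s`-stage Runge-Kutta method. -/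
structure RKMethod (s : ℕ) where
  A : Matrix (Fin s) (Fin s) ℝ
  b : Fin s → ℝ
  c : Fin s → ℝ

/-- Algebraic stability: the weights are nonnegative and the matrix
`m_{ij} = b_i a_{ij} + b_j a_{ji} - b_i b_j` is positive semidefinite. -/
def RKMethod.AlgebraicallyStable {s : ℕ} (rk : RKMethod s) : Prop :=
  (∀ i, 0 ≤ rk.b i) ∧
    (Matrix.of fun i j : Fin s =>
      rk.b i * rk.A i j + rk.b j * rk.A j i - rk.b i * rk.b j).PosSemidef

/-! ### GePUP-ES-RK schemes -/

/-- The data of the problem and of the discretization: viscosity `ν`, penalty parameter `lam`,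
initial time `t₀`, step size `k`, body force `g`, Runge-Kutta method `rk`. -/
structure Params (D s : ℕ) where
  ν : ℝ
  lam : ℝ
  t₀ : ℝ
  k : ℝ
  g : ℝ → Vec D → Vec D
  rk : RKMethod s
  ν_pos : 0 < ν
  lam_nonneg : 0 ≤ lam
  k_pos : 0 < k

/-- `g^{(i)} = g(tⁿ + cᵢ k)` with `tⁿ = t₀ + n k`, in the step from `tⁿ` to `tⁿ⁺¹`. -/
noncomputable def Params.force {D s : ℕ} (P : Params D s) (n : ℕ) (i : Fin s) : Vec D → Vec D :=
  P.g (P.t₀ + n * P.k + P.rk.c i * P.k)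

/-- The quantities computed by the scheme: the step values `wⁿ`, `uⁿ`, `rⁿ`, and the stage values
`w^{(i)}`, `u^{(i)}`, `q^{(i)}`, `r^{(i)}` and auxiliary velocities `ũ^{(i)}` in the step from
`tⁿ` to `tⁿ⁺¹`. -/
structure Trajectory (D s : ℕ) where
  w : ℕ → Vec D → Vec D
  u : ℕ → Vec D → Vec D
  r : ℕ → ℝ
  wStage : ℕ → Fin s → Vec D → Vec D
  uStage : ℕ → Fin s → Vec D → Vec D
  qStage : ℕ → Fin s → Vec D → ℝ
  rStage : ℕ → Fin s → ℝ
  uTilde : ℕ → Fin s → Vec D → Vec D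

/-- `g^{(i)} - r^{(i)} ũ^{(i)}·∇ũ^{(i)}`. -/
noncomputable def Trajectory.explicitTerm {D s : ℕ} (T : Trajectory D s) (P : Params D s)
    (n : ℕ) (i : Fin s) (x : Vec D) : Vec D :=
  P.force n i x - T.rStage n i • conv (T.uTilde n i) x

/-- `ρ^{(i)} = g^{(i)} - r^{(i)} ũ^{(i)}·∇ũ^{(i)} - ∇q^{(i)} + ν Δw^{(i)}`. -/
noncomputable def Trajectory.rho {D s : ℕ} (T : Trajectory D s) (P : Params D s)
    (n : ℕ) (i : Fin s) (x : Vec D) : Vec D :=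
  T.explicitTerm P n i x - gradient (T.qStage n i) x + P.ν • Laplacian.laplacian (T.wStage n i) x

/-- `T` is a (classical) run of the GePUP-ES-RK scheme on `Ω`. The auxiliary velocities
`ũ^{(i)}` are arbitrary sufficiently smooth fields. -/
structure IsGePUPESRK {D s : ℕ} (Ω : Set (Vec D)) (P : Params D s) (T : Trajectory D s) :
    Prop where
  -- smoothness up to the boundary
  w_reg : ∀ n, IsCk 1 Ω (T.w n)
  wStage_reg : ∀ n i, IsCk 3 Ω (T.wStage n i)
  qStage_reg : ∀ n i, IsCk 2 Ω (T.qStage n i)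
  uTilde_reg : ∀ n i, IsCk 2 Ω (T.uTilde n i)
  force_reg : ∀ n i, IsCk 1 Ω (P.force n i)
  -- the step
  w_step : ∀ n, ∀ x ∈ Ω, T.w (n + 1) x = T.w n x + P.k • ∑ i, P.rk.b i • T.rho P n i x
  r_step : ∀ n, T.r (n + 1) =
    T.r n + P.k * ∑ i, P.rk.b i * Icv Ω (T.uTilde n i) (T.uStage n i)
  u_step : ∀ n, IsLerayProjection Ω (T.w (n + 1)) (T.u (n + 1))
  -- the stages
  q_poisson : ∀ n i, ∀ x ∈ Ω,
    Laplacian.laplacian (T.qStage n i) x = divg (T.explicitTerm P n i) x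
  q_neumann : ∀ n i x ν, IsOutwardNormal Ω x ν →
    ⟪ν, bdryVal Ω (gradient (T.qStage n i)) x⟫ =
      ⟪ν, bdryVal Ω (fun y => T.explicitTerm P n i y +
          P.ν • Laplacian.laplacian (T.wStage n i) y) x⟫ +
        P.lam * ⟪ν, bdryVal Ω (T.wStage n i) x⟫
  w_stage : ∀ n i, ∀ x ∈ Ω,
    T.wStage n i x = T.w n x + P.k • ∑ j, P.rk.A i j • T.rho P n j x
  w_tangential : ∀ n i, HasZeroTangential Ω (T.wStage n i)
  w_divergence : ∀ n i, ∀ x ∈ frontier Ω, bdryVal Ω (divg (T.wStage n i)) x = 0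
  r_stage : ∀ n i, T.rStage n i =
    T.r n + P.k * ∑ j, P.rk.A i j * Icv Ω (T.uTilde n j) (T.uStage n j)
  u_stage : ∀ n i, IsLerayProjection Ω (T.wStage n i) (T.uStage n i)

end GePUP

namespace GePUP

/-! ### Algebraic stability -/

/-! Taking the divergence of `rho` and using the Poisson equation for `q` leaves `ν Δ dᵢ` with `dᵢ =
∇·w⁽ⁱ⁾` (`divg_rho`). So at every fixed point of `Ω` the numbers `∇·w` undergo a scalar Runge-Kutta
step with stage values `dᵢ` and slopes `ν Δ dᵢ`. If the step starts from zero, algebraic stability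
gives the pointwise bound `(∇·wⁿ⁺¹)² ≤ 2kν ∑ bᵢ dᵢ Δdᵢ` (`sq_le`).

The right side is therefore nonnegative in `Ω`. On the other hand `dᵢ` vanishes on the boundary, so
`∫ dᵢ Δdᵢ ≤ 0`, and all these integrals with `bᵢ > 0` must be zero. This forces `dᵢ = 0` for those
stages, and then the pointwise bound gives `∇·wⁿ⁺¹ = 0`. Induction on `n` finishes.

Green's identity is proved without a boundary integral. For a truncation `η` that vanishes near `0`,
the function `η(dᵢ)` extended by zero is `C¹` on the whole space with compact support inside `Ω`, so
one integrates by parts over `ℝ^D` and lets `η` tend to the identity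
(`exists_integral_comp_mul_laplacian` and its consequences).

The normal component is simpler: at a regular boundary point the Neumann condition for `q` gives
`n·ρ⁽ⁱ⁾ = -λ n·w⁽ⁱ⁾`, so `sq_le` applies to a scalar dissipative linear problem and no integration
is needed. -/

theorem RKMethod.AlgebraicallyStable.sq_le {s : ℕ} {rk : RKMethod s}
    (h : rk.AlgebraicallyStable) (k : ℝ) (Z L : Fin s → ℝ)
    (hZ : ∀ i, Z i = k * ∑ j, rk.A i j * L j) :
    (k * ∑ i, rk.b i * L i) ^ 2 ≤ 2 * k * ∑ i, rk.b i * (Z i * L i) := by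
  have h0 := h.2.dotProduct_mulVec_nonneg L
  simp only [dotProduct, Matrix.mulVec, Matrix.of_apply, Pi.star_apply, star_trivial,
    Finset.mul_sum] at h0
  -- The two mixed terms of `m` contribute equally to the quadratic form, by exchanging the
  -- summation indices.
  have h1 : ∑ i, ∑ j, L i * ((rk.b i * rk.A i j + rk.b j * rk.A j i - rk.b i * rk.b j) * L j)
      = 2 * ∑ i, ∑ j, rk.b i * rk.A i j * L i * L j - (∑ i, rk.b i * L i) ^ 2 := by
    have h2 : ∑ i, ∑ j, rk.b j * rk.A j i * L i * L j
        = ∑ i, ∑ j, rk.b i * rk.A i j * L i * L j := by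
      rw [Finset.sum_comm]
      exact Finset.sum_congr rfl fun i _ => Finset.sum_congr rfl fun j _ => by ring
    rw [sq, Finset.sum_mul_sum, two_mul]
    nth_rw 2 [← h2]
    simp only [← Finset.sum_add_distrib, ← Finset.sum_sub_distrib]
    exact Finset.sum_congr rfl fun i _ => Finset.sum_congr rfl fun j _ => by ring
  have h3 : ∑ i, rk.b i * (Z i * L i) = k * ∑ i, ∑ j, rk.b i * rk.A i j * L i * L j := by
    simp only [hZ, Finset.mul_sum, Finset.sum_mul]
    exact Finset.sum_congr rfl fun i _ => Finset.sum_congr rfl fun j _ => by ring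
  rw [h1] at h0
  rw [h3, mul_pow]
  -- Right side minus left side is exactly `k²` times the quadratic form of `m` at `L`.
  nlinarith [mul_nonneg (sq_nonneg k) h0]

/-! ### Differential operators -/

/-- The trace of a continuous linear endomorphism of `ℝ^D`. -/
noncomputable def traceCLM (D : ℕ) : (Vec D →L[ℝ] Vec D) →L[ℝ] ℝ :=
  ∑ j : Fin D, (EuclideanSpace.proj j : Vec D →L[ℝ] ℝ) ∘L
    ContinuousLinearMap.apply ℝ (Vec D) (EuclideanSpace.single j (1 : ℝ))

theorem traceCLM_apply {D : ℕ} (M : Vec D →L[ℝ] Vec D) :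
    traceCLM D M = ∑ j : Fin D, (M (EuclideanSpace.single j 1)) j := by
  simp [traceCLM]

theorem divg_eq_traceCLM {D : ℕ} (v : Vec D → Vec D) :
    divg v = fun x => traceCLM D (fderiv ℝ v x) := by
  ext x; rw [traceCLM_apply]; rfl

theorem divg_congr {D : ℕ} {Ω : Set (Vec D)} (hΩ : IsOpen Ω) {v w : Vec D → Vec D}
    (h : ∀ x ∈ Ω, v x = w x) {x : Vec D} (hx : x ∈ Ω) : divg v x = divg w x := by
  have : v =ᶠ[𝓝 x] w := by filter_upwards [hΩ.mem_nhds hx] with y hy using h y hy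
  simp only [divg, this.fderiv_eq]

section

variable {D : ℕ} {F : Type*} [NormedAddCommGroup F] [NormedSpace ℝ F]

theorem laplacian_eq_sum_iteratedFDeriv (f : Vec D → F) (x : Vec D) :
    Laplacian.laplacian f x = ∑ j : Fin D,
      iteratedFDeriv ℝ 2 f x ![EuclideanSpace.single j 1, EuclideanSpace.single j 1] := by
  rw [InnerProductSpace.laplacian_eq_iteratedFDeriv_orthonormalBasis f
    (EuclideanSpace.basisFun (Fin D) ℝ)]
  simp

theorem laplacian_eq_sum_fderiv (f : Vec D → F) (x : Vec D) :
    Laplacian.laplacian f x = ∑ j : Fin D,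
      fderiv ℝ (fderiv ℝ f) x (EuclideanSpace.single j 1) (EuclideanSpace.single j 1) := by
  rw [laplacian_eq_sum_iteratedFDeriv]
  simp [iteratedFDeriv_two_apply]

/-- The Laplacian as a continuous linear function of the second derivative. -/
noncomputable def laplacianCLM (D : ℕ) (F : Type*) [NormedAddCommGroup F] [NormedSpace ℝ F] :
    ContinuousMultilinearMap ℝ (fun _ : Fin 2 => Vec D) F →L[ℝ] F :=
  ∑ j : Fin D, ContinuousMultilinearMap.apply ℝ (fun _ : Fin 2 => Vec D) F
    ![EuclideanSpace.single j 1, EuclideanSpace.single j 1]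

theorem laplacian_eq_laplacianCLM (f : Vec D → F) :
    Laplacian.laplacian f = fun x => laplacianCLM D F (iteratedFDeriv ℝ 2 f x) := by
  ext x
  rw [laplacian_eq_sum_iteratedFDeriv]
  simp [laplacianCLM, ContinuousMultilinearMap.apply]

theorem contDiffAt_fderiv_of_succ {m : ℕ} {f : Vec D → F} {x : Vec D}
    (h : ContDiffAt ℝ (m + 1 : ℕ) f x) : ContDiffAt ℝ m (fderiv ℝ f) x :=
  h.fderiv_right (by norm_cast)

theorem differentiableAt_laplacian {w : Vec D → F} {x : Vec D} (h : ContDiffAt ℝ 3 w x) :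
    DifferentiableAt ℝ (Laplacian.laplacian w) x := by
  rw [laplacian_eq_laplacianCLM]
  exact (laplacianCLM D F).differentiableAt.comp x
    (h.differentiableAt_iteratedFDeriv (by norm_cast))

theorem norm_fderiv_laplacian_le {w : Vec D → F} {x : Vec D} (h : ContDiffAt ℝ 3 w x) :
    ‖fderiv ℝ (Laplacian.laplacian w) x‖ ≤ ‖laplacianCLM D F‖ * ‖iteratedFDeriv ℝ 3 w x‖ := by
  have h1 := (laplacianCLM D F).hasFDerivAt.comp x
    (h.differentiableAt_iteratedFDeriv (m := 2) (by norm_cast)).hasFDerivAt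
  rw [laplacian_eq_laplacianCLM]
  have h2 := h1.fderiv
  simp only [Function.comp_def] at h2
  rw [h2, ← norm_fderiv_iteratedFDeriv]
  exact ContinuousLinearMap.opNorm_comp_le _ _

theorem fderiv_fderiv_apply_comm {f : Vec D → F} {x : Vec D} (h : ContDiffAt ℝ 2 f x)
    (a b : Vec D) : fderiv ℝ (fderiv ℝ f) x a b = fderiv ℝ (fderiv ℝ f) x b a :=
  (h.isSymmSndFDerivAt (by simp)).eq a b

end

/-- The Riesz representation of linear functionals on `ℝ^D`. -/
noncomputable def rieszCLM (D : ℕ) : (Vec D →L[ℝ] ℝ) →L[ℝ] Vec D :=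
  ∑ j : Fin D, (ContinuousLinearMap.apply ℝ ℝ (EuclideanSpace.single j (1 : ℝ))).smulRight
    (EuclideanSpace.single j (1 : ℝ))

theorem rieszCLM_apply {D : ℕ} (l : Vec D →L[ℝ] ℝ) (j : Fin D) :
    rieszCLM D l j = l (EuclideanSpace.single j 1) := by
  simp [rieszCLM, Pi.single_apply]

theorem gradient_eq_rieszCLM {D : ℕ} (q : Vec D → ℝ) :
    gradient q = fun x => rieszCLM D (fderiv ℝ q x) := by
  ext x j
  rw [rieszCLM_apply]
  have h := InnerProductSpace.toDual_symm_apply (𝕜 := ℝ) (x := EuclideanSpace.single j (1 : ℝ))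
    (y := fderiv ℝ q x)
  rw [EuclideanSpace.inner_single_right] at h
  simpa [gradient] using h

theorem hasFDerivAt_gradient {D : ℕ} {q : Vec D → ℝ} {x : Vec D} (h : ContDiffAt ℝ 2 q x) :
    HasFDerivAt (gradient q) (rieszCLM D ∘L fderiv ℝ (fderiv ℝ q) x) x := by
  rw [gradient_eq_rieszCLM]
  exact (rieszCLM D).hasFDerivAt.comp x
    ((contDiffAt_fderiv_of_succ (m := 1) h).differentiableAt one_ne_zero).hasFDerivAt

theorem divg_gradient {D : ℕ} {q : Vec D → ℝ} {x : Vec D} (h : ContDiffAt ℝ 2 q x) :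
    divg (gradient q) x = Laplacian.laplacian q x := by
  rw [divg, (hasFDerivAt_gradient h).fderiv, laplacian_eq_sum_fderiv]
  exact Finset.sum_congr rfl fun j _ => rieszCLM_apply _ j

/-- Both sides are sums of third derivatives of `w`, which agree because the third derivative is
symmetric. This lets the slope be expressed through the divergence alone. -/
theorem divg_laplacian {D : ℕ} {w : Vec D → Vec D} {x : Vec D} (h : ContDiffAt ℝ 3 w x) :
    divg (Laplacian.laplacian w) x = Laplacian.laplacian (divg w) x := by
  have hd1 : ContDiffAt ℝ 2 (fderiv ℝ w) x := contDiffAt_fderiv_of_succ (m := 2) h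
  have hd2 : ContDiffAt ℝ 1 (fderiv ℝ (fderiv ℝ w)) x := contDiffAt_fderiv_of_succ (m := 1) hd1
  have hd2' := hd2.differentiableAt one_ne_zero
  have happ : ∀ a b v : Vec D, fderiv ℝ (fun y => fderiv ℝ (fderiv ℝ w) y a b) x v
      = fderiv ℝ (fderiv ℝ (fderiv ℝ w)) x v a b := by
    intro a b v
    have h1 := (hd2'.hasFDerivAt.clm_apply (hasFDerivAt_const a x)).clm_apply
      (hasFDerivAt_const b x)
    rw [h1.fderiv]
    simp
  -- The first two slots are exchanged by symmetry of the second derivative of `fderiv ℝ w`, the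
  -- last two by differentiating the symmetry of the second derivative of `w`.
  have hsymm : ∀ a b : Vec D, fderiv ℝ (fderiv ℝ (fderiv ℝ w)) x a b b
      = fderiv ℝ (fderiv ℝ (fderiv ℝ w)) x b b a := by
    intro a b
    rw [fderiv_fderiv_apply_comm hd1 a b, ← happ, ← happ]
    have : (fun y => fderiv ℝ (fderiv ℝ w) y a b) =ᶠ[𝓝 x]
        fun y => fderiv ℝ (fderiv ℝ w) y b a := by
      filter_upwards [h.eventually (by simp)] with y hy
      exact fderiv_fderiv_apply_comm (hy.of_le (by norm_cast)) a b
    rw [this.fderiv_eq]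
  have hL : ∀ i : Fin D, fderiv ℝ (Laplacian.laplacian w) x (EuclideanSpace.single i 1)
      = ∑ j : Fin D, fderiv ℝ (fderiv ℝ (fderiv ℝ w)) x (EuclideanSpace.single i 1)
        (EuclideanSpace.single j 1) (EuclideanSpace.single j 1) := by
    intro i
    have : (Laplacian.laplacian w) = fun y => ∑ j : Fin D, fderiv ℝ (fderiv ℝ w) y
        (EuclideanSpace.single j 1) (EuclideanSpace.single j 1) := by
      ext1 y; exact laplacian_eq_sum_fderiv w y
    rw [this, fderiv_fun_sum]
    · rw [_root_.sum_apply]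
      simp only [happ]
    · intro j _
      exact (hd2'.clm_apply (differentiableAt_const _)).clm_apply (differentiableAt_const _)
  have hR : Laplacian.laplacian (divg w) x = traceCLM D (Laplacian.laplacian (fderiv ℝ w) x) := by
    rw [divg_eq_traceCLM]
    exact hd1.laplacian_CLM_comp_left (l := traceCLM D)
  rw [hR, laplacian_eq_sum_fderiv, map_sum, divg]
  simp only [hL, traceCLM_apply, WithLp.ofLp_sum, Finset.sum_apply]
  rw [Finset.sum_comm]
  refine Finset.sum_congr rfl fun j _ => Finset.sum_congr rfl fun i _ => ?_
  rw [hsymm]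

/-! ### Regularity up to the boundary -/

/-- `bdryVal` is a meaningful limit only once a limit is known to exist; the existence lemmas below
supply this for each differential expression in the scheme. -/
theorem tendsto_bdryVal {D : ℕ} {F : Type*} [TopologicalSpace F] [T2Space F] {Ω : Set (Vec D)}
    {f : Vec D → F} {x : Vec D} (hx : x ∈ closure Ω)
    (h : ∃ L, Tendsto f (𝓝[Ω] x) (𝓝 L)) : Tendsto f (𝓝[Ω] x) (𝓝 (bdryVal Ω f x)) := by
  obtain ⟨L, hL⟩ := h
  rwa [bdryVal, extendFrom_eq hx hL]

theorem bdryVal_congr {D : ℕ} {F : Type*} [TopologicalSpace F] {Ω : Set (Vec D)}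
    {f g : Vec D → F} (h : ∀ y ∈ Ω, f y = g y) (x : Vec D) :
    bdryVal Ω f x = bdryVal Ω g x := by
  have : f =ᶠ[𝓝[Ω] x] g := by filter_upwards [self_mem_nhdsWithin] with y hy using h y hy
  simp only [bdryVal, extendFrom, limUnder, map_congr this]

section

variable {D k : ℕ} {F : Type*} [NormedAddCommGroup F] [NormedSpace ℝ F] {Ω : Set (Vec D)}
  {f : Vec D → F} {x : Vec D}

theorem IsCk.contDiffAt (hf : IsCk k Ω f) (hΩ : IsOpen Ω) (hx : x ∈ Ω) : ContDiffAt ℝ k f x :=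
  hf.1.contDiffAt (hΩ.mem_nhds hx)

theorem IsCk.tendsto_iteratedFDeriv (hf : IsCk k Ω f) {m : ℕ} (hm : m ≤ k)
    (hx : x ∈ closure Ω) : ∃ L, Tendsto (iteratedFDeriv ℝ m f) (𝓝[Ω] x) (𝓝 L) := by
  obtain ⟨G, hG, hGf⟩ := hf.2 m hm
  refine ⟨G x, ((hG x hx).mono subset_closure).congr' ?_⟩
  filter_upwards [self_mem_nhdsWithin] with y hy using hGf y hy

theorem IsCk.exists_norm_iteratedFDeriv_le (hf : IsCk k Ω f) (hb : Bornology.IsBounded Ω) {m : ℕ}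
    (hm : m ≤ k) : ∃ C, ∀ x ∈ Ω, ‖iteratedFDeriv ℝ m f x‖ ≤ C := by
  obtain ⟨G, hG, hGf⟩ := hf.2 m hm
  obtain ⟨C, hC⟩ := hb.isCompact_closure.exists_bound_of_continuousOn hG
  exact ⟨C, fun x hx => hGf x hx ▸ hC x (subset_closure hx)⟩

theorem IsCk.tendsto (hf : IsCk k Ω f) (hx : x ∈ closure Ω) :
    ∃ L, Tendsto f (𝓝[Ω] x) (𝓝 L) := by
  obtain ⟨L, hL⟩ := hf.tendsto_iteratedFDeriv (Nat.zero_le k) hx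
  exact ⟨_, ((continuousMultilinearCurryFin0 ℝ (Vec D) F).continuous.tendsto L).comp hL⟩

theorem IsCk.tendsto_fderiv (hf : IsCk k Ω f) (hk : 1 ≤ k) (hx : x ∈ closure Ω) :
    ∃ L, Tendsto (fderiv ℝ f) (𝓝[Ω] x) (𝓝 L) := by
  obtain ⟨L, hL⟩ := hf.tendsto_iteratedFDeriv hk hx
  refine ⟨_, (((continuousMultilinearCurryFin1 ℝ (Vec D) F).continuous.tendsto L).comp hL).congr
    fun y => ?_⟩
  ext v
  simp [iteratedFDeriv_one_apply]

theorem IsCk.tendsto_laplacian (hf : IsCk k Ω f) (hk : 2 ≤ k) (hx : x ∈ closure Ω) :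
    ∃ L, Tendsto (Laplacian.laplacian f) (𝓝[Ω] x) (𝓝 L) := by
  obtain ⟨L, hL⟩ := hf.tendsto_iteratedFDeriv hk hx
  rw [laplacian_eq_laplacianCLM]
  exact ⟨_, ((laplacianCLM D F).continuous.tendsto L).comp hL⟩

end

section

variable {D k : ℕ} {Ω : Set (Vec D)} {x : Vec D}

theorem IsCk.tendsto_conv {v : Vec D → Vec D} (hv : IsCk k Ω v) (hk : 1 ≤ k)
    (hx : x ∈ closure Ω) : ∃ L, Tendsto (conv v) (𝓝[Ω] x) (𝓝 L) := by
  obtain ⟨L, hL⟩ := hv.tendsto_fderiv hk hx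
  obtain ⟨l, hl⟩ := hv.tendsto hx
  exact ⟨L l, (isBoundedBilinearMap_apply.continuous.tendsto (L, l)).comp (hL.prodMk_nhds hl)⟩

theorem IsCk.tendsto_gradient {q : Vec D → ℝ} (hq : IsCk k Ω q) (hk : 1 ≤ k)
    (hx : x ∈ closure Ω) : ∃ L, Tendsto (gradient q) (𝓝[Ω] x) (𝓝 L) := by
  obtain ⟨L, hL⟩ := hq.tendsto_fderiv hk hx
  rw [gradient_eq_rieszCLM]
  exact ⟨_, ((rieszCLM D).continuous.tendsto L).comp hL⟩

theorem IsCk.tendsto_divg {v : Vec D → Vec D} (hv : IsCk k Ω v) (hk : 1 ≤ k)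
    (hx : x ∈ closure Ω) : ∃ L, Tendsto (divg v) (𝓝[Ω] x) (𝓝 L) := by
  obtain ⟨L, hL⟩ := hv.tendsto_fderiv hk hx
  rw [divg_eq_traceCLM]
  exact ⟨_, ((traceCLM D).continuous.tendsto L).comp hL⟩

theorem IsCk.contDiffOn_divg {m : ℕ} {v : Vec D → Vec D} (hv : IsCk (m + 1) Ω v)
    (hΩ : IsOpen Ω) : ContDiffOn ℝ m (divg v) Ω := by
  intro y hy
  rw [divg_eq_traceCLM]
  exact ((traceCLM D).contDiff.contDiffAt.comp y
    (contDiffAt_fderiv_of_succ (hv.contDiffAt hΩ hy))).contDiffWithinAt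

theorem IsCk.exists_abs_divg_le {v : Vec D → Vec D} (hv : IsCk k Ω v) (hk : 1 ≤ k)
    (hb : Bornology.IsBounded Ω) : ∃ C, ∀ x ∈ Ω, |divg v x| ≤ C := by
  obtain ⟨C, hC⟩ := hv.exists_norm_iteratedFDeriv_le hb hk
  refine ⟨‖traceCLM D‖ * C, fun y hy => ?_⟩
  rw [divg_eq_traceCLM, ← Real.norm_eq_abs]
  refine ((traceCLM D).le_opNorm _).trans ?_
  gcongr
  simpa [norm_iteratedFDeriv_one] using hC y hy

/-- After commuting `Δ` with the divergence, only third derivatives of `w` occur, and these are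
bounded because they extend continuously to a compact closure. -/
theorem IsCk.exists_abs_laplacian_divg_le {w : Vec D → Vec D} (hw : IsCk 3 Ω w)
    (hΩ : IsOpen Ω) (hb : Bornology.IsBounded Ω) :
    ∃ C, ∀ x ∈ Ω, |Laplacian.laplacian (divg w) x| ≤ C := by
  obtain ⟨C, hC⟩ := hw.exists_norm_iteratedFDeriv_le hb le_rfl
  refine ⟨‖traceCLM D‖ * (‖laplacianCLM D (Vec D)‖ * C), fun y hy => ?_⟩
  have hy3 : ContDiffAt ℝ 3 w y := hw.contDiffAt hΩ hy
  rw [← divg_laplacian hy3, divg_eq_traceCLM, ← Real.norm_eq_abs]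
  refine ((traceCLM D).le_opNorm _).trans ?_
  gcongr
  refine (norm_fderiv_laplacian_le hy3).trans ?_
  gcongr
  exact hC y hy

theorem IsCk.differentiableAt_conv {v : Vec D → Vec D} (hv : IsCk 2 Ω v) (hΩ : IsOpen Ω)
    (hx : x ∈ Ω) : DifferentiableAt ℝ (conv v) x := by
  have h : ContDiffAt ℝ 2 v x := hv.contDiffAt hΩ hx
  exact ((contDiffAt_fderiv_of_succ (m := 1) h).differentiableAt one_ne_zero).clm_apply
    (h.differentiableAt two_ne_zero)

end

/-! ### Smooth truncations -/

/-- A smooth nondecreasing truncation of the identity: it vanishes for `m |t| ≤ 1` and is the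
identity for `m |t| ≥ √2`. -/
noncomputable def trunc (m : ℕ) (t : ℝ) : ℝ :=
  t * Real.smoothTransition ((m : ℝ) ^ 2 * t ^ 2 - 1)

theorem contDiff_trunc (m : ℕ) : ContDiff ℝ 1 (trunc m) := by
  refine contDiff_id.mul ((Real.smoothTransition.contDiff (n := 1)).comp ?_)
  fun_prop

theorem trunc_eq_zero {m : ℕ} {t : ℝ} (h : (m : ℝ) ^ 2 * t ^ 2 ≤ 1) : trunc m t = 0 := by
  rw [trunc, Real.smoothTransition.zero_of_nonpos (by linarith), mul_zero]

theorem trunc_eq_self {m : ℕ} {t : ℝ} (h : 2 ≤ (m : ℝ) ^ 2 * t ^ 2) : trunc m t = t := by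
  rw [trunc, Real.smoothTransition.one_of_one_le (by linarith), mul_one]

theorem abs_trunc_le (m : ℕ) (t : ℝ) : |trunc m t| ≤ |t| := by
  rw [trunc, abs_mul, abs_of_nonneg (Real.smoothTransition.nonneg _)]
  exact mul_le_of_le_one_right (abs_nonneg _) (Real.smoothTransition.le_one _)

/-- With `S` the smooth transition, the derivative is `S + 2 m² t² S'`, and `S` is nonnegative and
nondecreasing. -/
theorem deriv_trunc_nonneg (m : ℕ) (t : ℝ) : 0 ≤ deriv (trunc m) t := by
  have h1 : HasDerivAt Real.smoothTransition
      (deriv Real.smoothTransition ((m : ℝ) ^ 2 * t ^ 2 - 1)) ((m : ℝ) ^ 2 * t ^ 2 - 1) :=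
    ((Real.smoothTransition.contDiff (n := 1)).differentiable one_ne_zero _).hasDerivAt
  have h2 : HasDerivAt (fun t : ℝ => (m : ℝ) ^ 2 * t ^ 2 - 1) ((m : ℝ) ^ 2 * (2 * t)) t := by
    simpa using ((hasDerivAt_pow 2 t).const_mul ((m : ℝ) ^ 2)).sub_const 1
  have h3 := ((hasDerivAt_id t).mul (h1.comp t h2)).deriv
  change deriv (trunc m) t = _ at h3
  rw [h3]
  have h4 : 0 ≤ deriv Real.smoothTransition ((m : ℝ) ^ 2 * t ^ 2 - 1) :=
    Real.smoothTransition.monotone.deriv_nonneg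
  have h5 := Real.smoothTransition.nonneg ((m : ℝ) ^ 2 * t ^ 2 - 1)
  have h6 : 0 ≤ deriv Real.smoothTransition ((m : ℝ) ^ 2 * t ^ 2 - 1) *
      ((m : ℝ) ^ 2 * (2 * t ^ 2)) := by positivity
  simp only [Function.comp_apply, id]
  nlinarith

theorem eventually_two_le_sq_mul_sq {t : ℝ} (ht : t ≠ 0) :
    ∀ᶠ m : ℕ in atTop, 2 ≤ (m : ℝ) ^ 2 * t ^ 2 := by
  have h : Tendsto (fun m : ℕ => (m : ℝ) ^ 2 * t ^ 2) atTop atTop :=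
    ((tendsto_pow_atTop two_ne_zero).comp tendsto_natCast_atTop_atTop).atTop_mul_const
      (by positivity)
  exact h.eventually_ge_atTop 2

theorem tendsto_trunc (t : ℝ) : Tendsto (fun m => trunc m t) atTop (𝓝 t) := by
  rcases eq_or_ne t 0 with rfl | ht
  · simp [trunc]
  · refine tendsto_const_nhds.congr' ?_
    filter_upwards [eventually_two_le_sq_mul_sq ht] with m hm using (trunc_eq_self hm).symm

theorem deriv_trunc_eq_one {m : ℕ} {t : ℝ} (h : 2 < (m : ℝ) ^ 2 * t ^ 2) :
    deriv (trunc m) t = 1 := by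
  have hc : ContinuousAt (fun t : ℝ => (m : ℝ) ^ 2 * t ^ 2) t := by fun_prop
  have : trunc m =ᶠ[𝓝 t] id := by
    filter_upwards [hc.eventually (lt_mem_nhds h)] with u hu using trunc_eq_self hu.le
  rw [this.deriv_eq, deriv_id]

theorem eventually_trunc_eq_zero (m : ℕ) : ∀ᶠ t in 𝓝 (0 : ℝ), trunc m t = 0 := by
  have hc : ContinuousAt (fun t : ℝ => (m : ℝ) ^ 2 * t ^ 2) 0 := by fun_prop
  filter_upwards [hc.eventually (gt_mem_nhds (by simp : (m : ℝ) ^ 2 * (0 : ℝ) ^ 2 < 1))] with u hu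
    using trunc_eq_zero hu.le

/-! ### Green's identity for functions vanishing on the boundary -/

section

/-- Nothing is known about `a` outside `Ω`, but there `g` vanishes on a whole neighbourhood, since
its support is closed. -/
theorem continuous_mul_of_tsupport_subset {X : Type*} [TopologicalSpace X] {Ω : Set X}
    (hΩ : IsOpen Ω) {a g : X → ℝ} (ha : ContinuousOn a Ω) (hg : Continuous g)
    (h : tsupport g ⊆ Ω) : Continuous fun x => a x * g x := by
  rw [continuous_iff_continuousAt]
  intro x
  by_cases hx : x ∈ Ω
  · exact (ha.continuousAt (hΩ.mem_nhds hx)).mul hg.continuousAt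
  · have h1 := notMem_tsupport_iff_eventuallyEq.1 fun hx' => hx (h hx')
    refine (continuousAt_const (y := (0 : ℝ))).congr ?_
    filter_upwards [h1] with y hy
    simp [hy]

variable {D : ℕ} {Ω : Set (Vec D)} {f : Vec D → ℝ} {η : ℝ → ℝ}

/-- Near a boundary point `f` is so small that `η` kills it. Hence extension by zero preserves
smoothness, whatever the shape of the boundary. -/
theorem indicator_comp_eventuallyEq_zero (hΩ : IsOpen Ω)
    (h0 : ∀ x ∈ frontier Ω, Tendsto f (𝓝[Ω] x) (𝓝 0)) (hη0 : ∀ᶠ t in 𝓝 (0 : ℝ), η t = 0)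
    {x : Vec D} (hx : x ∉ Ω) : Ω.indicator (fun y => η (f y)) =ᶠ[𝓝 x] 0 := by
  by_cases hc : x ∈ closure Ω
  · have h1 := (h0 x ⟨hc, by rwa [hΩ.interior_eq]⟩).eventually hη0
    filter_upwards [eventually_nhdsWithin_iff.1 h1] with y hy
    by_cases hyΩ : y ∈ Ω
    · simp [hyΩ, hy hyΩ]
    · simp [hyΩ]
  · filter_upwards [isClosed_closure.isOpen_compl.mem_nhds hc] with y hy
    simp [show y ∉ Ω from fun h => hy (subset_closure h)]

theorem tsupport_indicator_comp_subset (hΩ : IsOpen Ω)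
    (h0 : ∀ x ∈ frontier Ω, Tendsto f (𝓝[Ω] x) (𝓝 0)) (hη0 : ∀ᶠ t in 𝓝 (0 : ℝ), η t = 0) :
    tsupport (Ω.indicator fun y => η (f y)) ⊆ Ω := by
  intro x hx
  by_contra hxΩ
  exact notMem_tsupport_iff_eventuallyEq.2
    (indicator_comp_eventuallyEq_zero hΩ h0 hη0 hxΩ) hx

theorem hasCompactSupport_indicator (hb : Bornology.IsBounded Ω) (g : Vec D → ℝ) :
    HasCompactSupport (Ω.indicator g) :=
  HasCompactSupport.of_support_subset_isCompact hb.isCompact_closure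
    (Set.support_indicator_subset.trans subset_closure)

theorem indicator_eventuallyEq (hΩ : IsOpen Ω) (g : Vec D → ℝ) {x : Vec D} (hx : x ∈ Ω) :
    Ω.indicator g =ᶠ[𝓝 x] g := by
  filter_upwards [hΩ.mem_nhds hx] with y hy
  simp [hy]

theorem contDiff_indicator_comp (hΩ : IsOpen Ω) (hf : ContDiffOn ℝ 2 f Ω)
    (h0 : ∀ x ∈ frontier Ω, Tendsto f (𝓝[Ω] x) (𝓝 0)) (hη : ContDiff ℝ 1 η)
    (hη0 : ∀ᶠ t in 𝓝 (0 : ℝ), η t = 0) : ContDiff ℝ 1 (Ω.indicator fun y => η (f y)) := by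
  rw [contDiff_iff_contDiffAt]
  intro x
  by_cases hx : x ∈ Ω
  · refine ContDiffAt.congr_of_eventuallyEq ?_ (indicator_eventuallyEq hΩ _ hx)
    exact hη.contDiffAt.comp x ((hf.contDiffAt (hΩ.mem_nhds hx)).of_le one_le_two)
  · exact contDiffAt_const.congr_of_eventuallyEq
      (indicator_comp_eventuallyEq_zero hΩ h0 hη0 hx)

theorem fderiv_indicator_comp_of_mem (hΩ : IsOpen Ω) (hf : ContDiffOn ℝ 2 f Ω)
    (hη : ContDiff ℝ 1 η) {x : Vec D} (hx : x ∈ Ω) :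
    fderiv ℝ (Ω.indicator fun y => η (f y)) x = deriv η (f x) • fderiv ℝ f x := by
  rw [(indicator_eventuallyEq hΩ _ hx).fderiv_eq]
  exact ((hη.differentiable one_ne_zero (f x)).hasDerivAt.comp_hasFDerivAt x
    ((hf.contDiffAt (hΩ.mem_nhds hx)).differentiableAt two_ne_zero).hasFDerivAt).fderiv

theorem fderiv_indicator_comp_of_notMem (hΩ : IsOpen Ω)
    (h0 : ∀ x ∈ frontier Ω, Tendsto f (𝓝[Ω] x) (𝓝 0)) (hη0 : ∀ᶠ t in 𝓝 (0 : ℝ), η t = 0)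
    {x : Vec D} (hx : x ∉ Ω) : fderiv ℝ (Ω.indicator fun y => η (f y)) x = 0 := by
  rw [(indicator_comp_eventuallyEq_zero hΩ h0 hη0 hx).fderiv_eq]
  simp

theorem contDiffOn_fderiv (hΩ : IsOpen Ω) (hf : ContDiffOn ℝ 2 f Ω) :
    ContDiffOn ℝ 1 (fderiv ℝ f) Ω := fun _ hx =>
  (contDiffAt_fderiv_of_succ (m := 1) (hf.contDiffAt (hΩ.mem_nhds hx))).contDiffWithinAt

theorem continuousOn_laplacian (hΩ : IsOpen Ω) (hf : ContDiffOn ℝ 2 f Ω) :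
    ContinuousOn (Laplacian.laplacian f) Ω := by
  have h2 : ContinuousOn (fderiv ℝ (fderiv ℝ f)) Ω :=
    (contDiffOn_fderiv hΩ hf).continuousOn_fderiv_of_isOpen hΩ le_rfl
  simp only [funext (laplacian_eq_sum_fderiv f)]
  fun_prop

/-- Green's identity `∫ η(f) Δf = - ∫ η'(f) |∇f|²`, where `η` vanishes near `0` and `f` vanishes on
the boundary; the integrand on the right is continuous with compact support. -/
theorem exists_integral_comp_mul_laplacian (hΩ : IsOpen Ω) (hb : Bornology.IsBounded Ω)
    (hf : ContDiffOn ℝ 2 f Ω) (h0 : ∀ x ∈ frontier Ω, Tendsto f (𝓝[Ω] x) (𝓝 0))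
    (hη : ContDiff ℝ 1 η) (hη0 : ∀ᶠ t in 𝓝 (0 : ℝ), η t = 0) :
    ∃ W : Vec D → ℝ, Integrable W ∧
      (∀ x ∈ Ω, W x = deriv η (f x) * ∑ j, (fderiv ℝ f x (EuclideanSpace.single j 1)) ^ 2) ∧
      (∀ x ∉ Ω, W x = 0) ∧
      ∫ x in Ω, η (f x) * Laplacian.laplacian f x = - ∫ x, W x := by
  set G : Vec D → ℝ := Ω.indicator fun y => η (f y) with hG
  have hGd : ContDiff ℝ 1 G := contDiff_indicator_comp hΩ hf h0 hη hη0
  have hGt : tsupport G ⊆ Ω := tsupport_indicator_comp_subset hΩ h0 hη0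
  have hGc : HasCompactSupport G := hasCompactSupport_indicator hb _
  set e : Fin D → Vec D := fun j => EuclideanSpace.single j 1 with he
  have hf1 := contDiffOn_fderiv hΩ hf
  have hf2 : ContinuousOn (fderiv ℝ (fderiv ℝ f)) Ω := hf1.continuousOn_fderiv_of_isOpen hΩ le_rfl
  have hG' : ∀ j, Continuous fun x => fderiv ℝ G x (e j) := fun j =>
    (hGd.continuous_fderiv one_ne_zero).clm_apply continuous_const
  have hG't : ∀ j, tsupport (fun x => fderiv ℝ G x (e j)) ⊆ tsupport G := fun j =>
    tsupport_fderiv_apply_subset ℝ (e j)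
  have hG'c : ∀ j, HasCompactSupport fun x => fderiv ℝ G x (e j) := fun j =>
    hGc.fderiv_apply ℝ (e j)
  have hI1 : ∀ j, Integrable fun x => fderiv ℝ (fderiv ℝ f) x (e j) (e j) * G x := fun j =>
    (continuous_mul_of_tsupport_subset hΩ ((hf2.clm_apply continuousOn_const).clm_apply
      continuousOn_const) hGd.continuous hGt).integrable_of_hasCompactSupport hGc.mul_left
  have hI2 : ∀ j, Integrable fun x => fderiv ℝ f x (e j) * fderiv ℝ G x (e j) := fun j =>
    (continuous_mul_of_tsupport_subset hΩ (hf1.continuousOn.clm_apply continuousOn_const)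
      (hG' j) ((hG't j).trans hGt)).integrable_of_hasCompactSupport (hG'c j).mul_left
  have hI3 : ∀ j, Integrable fun x => fderiv ℝ f x (e j) * G x := fun j =>
    (continuous_mul_of_tsupport_subset hΩ (hf1.continuousOn.clm_apply continuousOn_const)
      hGd.continuous hGt).integrable_of_hasCompactSupport hGc.mul_left
  have hparts : ∀ j, ∫ x, fderiv ℝ f x (e j) * fderiv ℝ G x (e j)
      = - ∫ x, fderiv ℝ (fderiv ℝ f) x (e j) (e j) * G x := by
    intro j
    -- Differentiability of `fderiv ℝ f` is only required on the support of `G`, which lies in `Ω`.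
    refine integral_bilinear_hasLineDerivAt_right_eq_neg_left_of_integrable
      (B := ContinuousLinearMap.mul ℝ ℝ) (v := e j) (hI1 j) (hI2 j) (hI3 j) ?_ ?_
    · intro x hx
      have h1 := ((hf1.contDiffAt (hΩ.mem_nhds (hGt hx))).differentiableAt
        one_ne_zero).hasFDerivAt.clm_apply (hasFDerivAt_const (e j) x)
      simpa using h1.hasLineDerivAt (e j)
    · intro x _
      exact (hGd.differentiable one_ne_zero x).hasFDerivAt.hasLineDerivAt (e j)
  refine ⟨fun x => ∑ j, fderiv ℝ f x (e j) * fderiv ℝ G x (e j),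
    integrable_finsetSum _ fun j _ => hI2 j, ?_, ?_, ?_⟩
  · intro x hx
    simp only [hG, fderiv_indicator_comp_of_mem hΩ hf hη hx, Finset.mul_sum]
    exact Finset.sum_congr rfl fun j _ => by simp [he]; ring
  · intro x hx
    simp [hG, fderiv_indicator_comp_of_notMem hΩ h0 hη0 hx]
  · rw [integral_finsetSum _ fun j _ => hI2 j]
    simp only [hparts, Finset.sum_neg_distrib, neg_neg]
    rw [← integral_finsetSum _ fun j _ => hI1 j, ← integral_indicator hΩ.measurableSet]
    congr 1
    ext x
    by_cases hx : x ∈ Ω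
    · simp [hG, hx, laplacian_eq_sum_fderiv, he, mul_comm, Finset.mul_sum]
    · simp [hG, hx]

/-- Dominated convergence: truncation does not increase `|f|`, so the product of the two bounds
dominates, and `Ω` has finite volume. -/
theorem integrableOn_and_tendsto_integral_trunc_mul_laplacian (hΩ : IsOpen Ω) (hb : Bornology.IsBounded Ω)
    (hf : ContDiffOn ℝ 2 f Ω) (hfC : ∃ C, ∀ x ∈ Ω, |f x| ≤ C) (hΔC : ∃ C, ∀ x ∈ Ω, |Laplacian.laplacian f x| ≤ C) :
    IntegrableOn (fun x => f x * Laplacian.laplacian f x) Ω ∧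
    Tendsto (fun m => ∫ x in Ω, trunc m (f x) * Laplacian.laplacian f x) atTop
      (𝓝 (∫ x in Ω, f x * Laplacian.laplacian f x)) := by
  obtain ⟨C, hC⟩ := hfC
  obtain ⟨K, hK⟩ := hΔC
  have hfin : IsFiniteMeasure (volume.restrict Ω) := ⟨by simpa using hb.measure_lt_top⟩
  have hcΔ := continuousOn_laplacian hΩ hf
  have hm : ∀ {g : ℝ → ℝ}, Continuous g → AEStronglyMeasurable
      (fun x => g (f x) * Laplacian.laplacian f x) (volume.restrict Ω) := fun hg =>
    ((hg.comp_continuousOn hf.continuousOn).mul hcΔ).aestronglyMeasurable hΩ.measurableSet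
  have hbd : ∀ {g : ℝ → ℝ}, (∀ t, |g t| ≤ |t|) →
      ∀ᵐ x ∂volume.restrict Ω, ‖g (f x) * Laplacian.laplacian f x‖ ≤ C * K := by
    intro g hg
    filter_upwards [ae_restrict_mem hΩ.measurableSet] with x hx
    rw [norm_mul, Real.norm_eq_abs, Real.norm_eq_abs]
    exact mul_le_mul ((hg _).trans (hC x hx)) (hK x hx) (abs_nonneg _)
      ((abs_nonneg _).trans (hC x hx))
  refine ⟨Integrable.of_bound (hm continuous_id) (C * K) (hbd fun t => le_rfl), ?_⟩
  refine tendsto_integral_of_dominated_convergence (fun _ => C * K)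
    (fun m => hm (contDiff_trunc m).continuous) (integrable_const _)
    (fun m => hbd (abs_trunc_le m)) (ae_of_all _ fun x => ?_)
  exact (tendsto_trunc (f x)).mul_const _

/-- If `f` vanishes on the boundary, then `∫ f Δf ≤ 0`. -/
theorem integral_mul_laplacian_nonpos (hΩ : IsOpen Ω) (hb : Bornology.IsBounded Ω)
    (hf : ContDiffOn ℝ 2 f Ω) (h0 : ∀ x ∈ frontier Ω, Tendsto f (𝓝[Ω] x) (𝓝 0))
    (hfC : ∃ C, ∀ x ∈ Ω, |f x| ≤ C) (hΔC : ∃ C, ∀ x ∈ Ω, |Laplacian.laplacian f x| ≤ C) :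
    ∫ x in Ω, f x * Laplacian.laplacian f x ≤ 0 := by
  refine le_of_tendsto (integrableOn_and_tendsto_integral_trunc_mul_laplacian hΩ hb hf hfC hΔC).2
    (Eventually.of_forall fun m => ?_)
  obtain ⟨W, -, hW1, hW2, hW⟩ := exists_integral_comp_mul_laplacian hΩ hb hf h0
    (contDiff_trunc m) (eventually_trunc_eq_zero m)
  rw [hW, neg_nonpos]
  refine integral_nonneg fun x => ?_
  by_cases hx : x ∈ Ω
  · rw [hW1 x hx]
    exact mul_nonneg (deriv_trunc_nonneg m _) (Finset.sum_nonneg fun j _ => sq_nonneg _)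
  · rw [hW2 x hx]; rfl

/-- If `f` vanishes on the boundary and `∫ f Δf = 0`, then `∇f = 0` wherever `f ≠ 0`. -/
theorem fderiv_eq_zero_of_integral_mul_laplacian_nonneg (hΩ : IsOpen Ω)
    (hb : Bornology.IsBounded Ω)
    (hf : ContDiffOn ℝ 2 f Ω) (h0 : ∀ x ∈ frontier Ω, Tendsto f (𝓝[Ω] x) (𝓝 0))
    (hfC : ∃ C, ∀ x ∈ Ω, |f x| ≤ C) (hΔC : ∃ C, ∀ x ∈ Ω, |Laplacian.laplacian f x| ≤ C)
    (hint : 0 ≤ ∫ x in Ω, f x * Laplacian.laplacian f x) {x₀ : Vec D} (hx₀ : x₀ ∈ Ω)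
    (hfx : f x₀ ≠ 0) : fderiv ℝ f x₀ = 0 := by
  set S : Vec D → ℝ := fun x => ∑ j, (fderiv ℝ f x (EuclideanSpace.single j 1)) ^ 2 with hS
  have hSn : ∀ x, 0 ≤ S x := fun x => Finset.sum_nonneg fun j _ => sq_nonneg _
  suffices hS0 : S x₀ = 0 by
    have h1 := (Finset.sum_eq_zero_iff_of_nonneg fun j _ => sq_nonneg _).1 hS0
    refine ContinuousLinearMap.coe_injective
      ((EuclideanSpace.basisFun (Fin D) ℝ).toBasis.ext fun j => ?_)
    simpa using h1 j (Finset.mem_univ j)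
  -- If the gradient is nonzero at `x₀`, then on a small ball `S` and `f²` exceed half their values
  -- at `x₀`. For large `m` the truncation has slope `1` there, so the truncated integrals stay
  -- below a negative constant independent of `m`, while their limit is `0`.
  by_contra hne
  have hpos : 0 < S x₀ := lt_of_le_of_ne (hSn x₀) (Ne.symm hne)
  have hnhds := hΩ.mem_nhds hx₀
  have hcS : ContinuousAt S x₀ := by
    have h1 := (contDiffOn_fderiv hΩ hf).continuousOn.continuousAt hnhds
    exact tendsto_finsetSum _ fun j _ => (h1.clm_apply continuousAt_const).pow 2
  have hcf : ContinuousAt (fun x => f x ^ 2) x₀ := (hf.continuousOn.continuousAt hnhds).pow 2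
  have hf0 : 0 < f x₀ ^ 2 := by positivity
  obtain ⟨r, hr, hball⟩ := Metric.mem_nhds_iff.1 (inter_mem hnhds (inter_mem
    (hcS.eventually (lt_mem_nhds (half_lt_self hpos)))
    (hcf.eventually (lt_mem_nhds (half_lt_self hf0)))))
  have hlim := (integrableOn_and_tendsto_integral_trunc_mul_laplacian hΩ hb hf hfC hΔC).2
  have hint0 := le_antisymm (integral_mul_laplacian_nonpos hΩ hb hf h0 hfC hΔC) hint
  rw [hint0] at hlim
  have hvol : 0 < (volume (Metric.ball x₀ r)).toReal :=
    ENNReal.toReal_pos (Metric.measure_ball_pos volume x₀ hr).ne' measure_ball_lt_top.ne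
  have hev : ∀ᶠ m : ℕ in atTop, ∫ x in Ω, trunc m (f x) * Laplacian.laplacian f x
      ≤ -(S x₀ / 2 * (volume (Metric.ball x₀ r)).toReal) := by
    -- This argument turns the condition on `m` into `2 ≤ m² f(x₀)² / 2`, which matches the lower
    -- bound for `f²` on the ball.
    have hs : Real.sqrt (f x₀ ^ 2 / 2) ≠ 0 := by positivity
    filter_upwards [eventually_two_le_sq_mul_sq hs, eventually_gt_atTop 0] with m hm hm0
    rw [Real.sq_sqrt (by positivity)] at hm
    obtain ⟨W, hWi, hW1, hW2, hW⟩ := exists_integral_comp_mul_laplacian hΩ hb hf h0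
      (contDiff_trunc m) (eventually_trunc_eq_zero m)
    have hWn : ∀ x, 0 ≤ W x := by
      intro x
      by_cases hx : x ∈ Ω
      · rw [hW1 x hx]
        exact mul_nonneg (deriv_trunc_nonneg m _) (hSn x)
      · rw [hW2 x hx]
    rw [hW, neg_le_neg_iff]
    refine le_trans ?_ (setIntegral_le_integral (s := Metric.ball x₀ r) hWi (ae_of_all _ hWn))
    refine setIntegral_ge_of_const_le_real measurableSet_ball measure_ball_lt_top.ne
      (fun x hx => ?_) hWi.integrableOn
    obtain ⟨hxΩ, hxS, hxf⟩ := hball hx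
    rw [hW1 x hxΩ, deriv_trunc_eq_one, one_mul]
    · exact le_of_lt hxS
    · have hmp : (0 : ℝ) < (m : ℝ) ^ 2 := by positivity
      exact hm.trans_lt (mul_lt_mul_of_pos_left hxf hmp)
  have h2 := le_of_tendsto hlim hev
  nlinarith [mul_pos (half_pos hpos) hvol]

/-- If `f` vanishes on the boundary and `∫ f Δf = 0`, then `f = 0`. -/
theorem eq_zero_of_integral_mul_laplacian_nonneg (hD : D ≠ 0) (hΩ : IsOpen Ω)
    (hb : Bornology.IsBounded Ω)
    (hf : ContDiffOn ℝ 2 f Ω) (h0 : ∀ x ∈ frontier Ω, Tendsto f (𝓝[Ω] x) (𝓝 0))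
    (hfC : ∃ C, ∀ x ∈ Ω, |f x| ≤ C) (hΔC : ∃ C, ∀ x ∈ Ω, |Laplacian.laplacian f x| ≤ C)
    (hint : 0 ≤ ∫ x in Ω, f x * Laplacian.laplacian f x) {x : Vec D} (hx : x ∈ Ω) :
    f x = 0 := by
  have hout : ∃ z, z ∉ Ω := by
    by_contra! hall
    have : Nonempty (Fin D) := Fin.pos_iff_nonempty.1 (Nat.pos_of_ne_zero hD)
    exact NormedSpace.unbounded_univ ℝ (Vec D) (hb.subset fun z _ => hall z)
  obtain ⟨z, hz⟩ := hout
  -- The truncated function extended by zero has zero derivative on the whole space, so it is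
  -- constant and equals its value `0` at `z`. At zeros of `f` the derivative vanishes because the
  -- truncation is flat near `0`.
  have hm : ∀ m, trunc m (f x) = 0 := by
    intro m
    have hη := contDiff_trunc m
    have hη0 := eventually_trunc_eq_zero m
    have hconst := is_const_of_fderiv_eq_zero (𝕜 := ℝ)
      ((contDiff_indicator_comp hΩ hf h0 hη hη0).differentiable one_ne_zero) (fun y => by
        by_cases hy : y ∈ Ω
        · rw [fderiv_indicator_comp_of_mem hΩ hf hη hy]
          by_cases hfy : f y = 0
          · have h1 : trunc m =ᶠ[𝓝 0] fun _ => 0 := hη0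
            rw [hfy, h1.deriv_eq, deriv_const, zero_smul]
          · rw [fderiv_eq_zero_of_integral_mul_laplacian_nonneg hΩ hb hf h0 hfC hΔC hint hy hfy,
              smul_zero]
        · exact fderiv_indicator_comp_of_notMem hΩ h0 hη0 hy) x z
    simpa [hx, hz] using hconst
  exact tendsto_nhds_unique (tendsto_trunc (f x)) (by simp [hm])

end

/-! ### The scheme -/

section

variable {D s : ℕ} {Ω : Set (Vec D)} {P : Params D s} {T : Trajectory D s}

theorem IsGePUPESRK.differentiableAt_explicitTerm (hT : IsGePUPESRK Ω P T) (hΩ : IsOpen Ω)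
    (n : ℕ) (i : Fin s) {x : Vec D} (hx : x ∈ Ω) :
    DifferentiableAt ℝ (T.explicitTerm P n i) x :=
  (((hT.force_reg n i).contDiffAt hΩ hx).differentiableAt one_ne_zero).sub
    (((hT.uTilde_reg n i).differentiableAt_conv hΩ hx).fun_const_smul _)

theorem IsGePUPESRK.differentiableAt_rho (hT : IsGePUPESRK Ω P T) (hΩ : IsOpen Ω)
    (n : ℕ) (i : Fin s) {x : Vec D} (hx : x ∈ Ω) : DifferentiableAt ℝ (T.rho P n i) x :=
  ((hT.differentiableAt_explicitTerm hΩ n i hx).sub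
    (hasFDerivAt_gradient ((hT.qStage_reg n i).contDiffAt hΩ hx)).differentiableAt).add
    ((differentiableAt_laplacian ((hT.wStage_reg n i).contDiffAt hΩ hx)).fun_const_smul _)

theorem IsGePUPESRK.divg_rho (hT : IsGePUPESRK Ω P T) (hΩ : IsOpen Ω)
    (n : ℕ) (i : Fin s) {x : Vec D} (hx : x ∈ Ω) :
    divg (T.rho P n i) x = P.ν * Laplacian.laplacian (divg (T.wStage n i)) x := by
  have hq : ContDiffAt ℝ 2 (T.qStage n i) x := (hT.qStage_reg n i).contDiffAt hΩ hx
  have hw : ContDiffAt ℝ 3 (T.wStage n i) x := (hT.wStage_reg n i).contDiffAt hΩ hx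
  have h := (((hT.differentiableAt_explicitTerm hΩ n i hx).hasFDerivAt.sub
    (hasFDerivAt_gradient hq).differentiableAt.hasFDerivAt).add
    ((differentiableAt_laplacian hw).hasFDerivAt.const_smul P.ν)).fderiv
  change fderiv ℝ (T.rho P n i) x = _ at h
  have hqp := hT.q_poisson n i x hx
  rw [← divg_gradient hq] at hqp
  rw [← divg_laplacian hw]
  rw [divg_eq_traceCLM, divg_eq_traceCLM] at *
  simp only at hqp ⊢
  rw [h, map_add, map_sub, map_smul, hqp, sub_self, zero_add, smul_eq_mul]

/-- The coefficients `c` are free so that the same formula serves the stages (rows of `A`) and the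
step (the weights `b`). -/
theorem IsGePUPESRK.divg_add_smul_sum_rho (hT : IsGePUPESRK Ω P T) (hΩ : IsOpen Ω)
    (n : ℕ) (c : Fin s → ℝ) {v : Vec D → Vec D}
    (hv : ∀ x ∈ Ω, v x = T.w n x + P.k • ∑ i, c i • T.rho P n i x) {x : Vec D} (hx : x ∈ Ω) :
    divg v x = divg (T.w n) x +
      P.k * ∑ i, c i * (P.ν * Laplacian.laplacian (divg (T.wStage n i)) x) := by
  rw [divg_congr hΩ hv hx]
  have h := ((((hT.w_reg n).contDiffAt hΩ hx).differentiableAt one_ne_zero).hasFDerivAt.add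
    ((HasFDerivAt.fun_sum (u := Finset.univ) fun i _ =>
      ((hT.differentiableAt_rho hΩ n i hx).hasFDerivAt.const_smul (c i))).const_smul P.k)).fderiv
  simp only [← hT.divg_rho hΩ n _ hx]
  simp only [divg_eq_traceCLM]
  change fderiv ℝ (fun y => T.w n y + P.k • ∑ i, c i • T.rho P n i y) x = _ at h
  rw [h]
  simp

theorem IsGePUPESRK.tendsto_divg_wStage (hT : IsGePUPESRK Ω P T) (n : ℕ) (i : Fin s)
    {x : Vec D} (hx : x ∈ frontier Ω) :
    Tendsto (divg (T.wStage n i)) (𝓝[Ω] x) (𝓝 0) := by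
  have hxc := frontier_subset_closure hx
  have h := tendsto_bdryVal hxc ((hT.wStage_reg n i).tendsto_divg (by norm_num) hxc)
  rwa [hT.w_divergence n i x hx] at h

/-- One step of the scheme preserves `∇·w = 0`, and the stages with positive weights are
solenoidal. -/
theorem IsGePUPESRK.divg_step (hT : IsGePUPESRK Ω P T) (hΩ : IsOpen Ω)
    (hb : Bornology.IsBounded Ω) (hstable : P.rk.AlgebraicallyStable) (n : ℕ)
    (hn : ∀ x ∈ Ω, divg (T.w n) x = 0) :
    (∀ x ∈ Ω, divg (T.w (n + 1)) x = 0) ∧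
      ∀ i, 0 < P.rk.b i → ∀ x ∈ Ω, divg (T.wStage n i) x = 0 := by
  -- In dimension zero `Ω` may be the whole space, so there need be no point outside it; the
  -- divergence is then an empty sum.
  rcases eq_or_ne D 0 with rfl | hD
  · simp [divg]
  set d : Fin s → Vec D → ℝ := fun i => divg (T.wStage n i) with hd
  have hreg : ∀ i, ContDiffOn ℝ 2 (d i) Ω := fun i =>
    (hT.wStage_reg n i).contDiffOn_divg (m := 2) hΩ
  have h0 : ∀ i, ∀ x ∈ frontier Ω, Tendsto (d i) (𝓝[Ω] x) (𝓝 0) := fun i x hx =>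
    hT.tendsto_divg_wStage n i hx
  have hC : ∀ i, ∃ C, ∀ x ∈ Ω, |d i x| ≤ C := fun i =>
    (hT.wStage_reg n i).exists_abs_divg_le (by norm_num) hb
  have hΔ : ∀ i, ∃ C, ∀ x ∈ Ω, |Laplacian.laplacian (d i) x| ≤ C := fun i =>
    (hT.wStage_reg n i).exists_abs_laplacian_divg_le hΩ hb
  have hint : ∀ i, IntegrableOn (fun x => d i x * Laplacian.laplacian (d i) x) Ω := fun i =>
    (integrableOn_and_tendsto_integral_trunc_mul_laplacian hΩ hb (hreg i) (hC i) (hΔ i)).1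
  have hneg : ∀ i, ∫ x in Ω, d i x * Laplacian.laplacian (d i) x ≤ 0 := fun i =>
    integral_mul_laplacian_nonpos hΩ hb (hreg i) (h0 i) (hC i) (hΔ i)
  have hk := P.k_pos
  have hν := P.ν_pos
  have hpt : ∀ x ∈ Ω, divg (T.w (n + 1)) x ^ 2
      ≤ 2 * P.k * P.ν * ∑ i, P.rk.b i * (d i x * Laplacian.laplacian (d i) x) := by
    intro x hx
    have h1 := hstable.sq_le P.k (fun i => d i x)
      (fun i => P.ν * Laplacian.laplacian (d i) x) (fun i => by
        have h2 := hT.divg_add_smul_sum_rho hΩ n (P.rk.A i) (hT.w_stage n i) hx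
        rwa [hn x hx, zero_add] at h2)
    rw [hT.divg_add_smul_sum_rho hΩ n P.rk.b (hT.w_step n) hx, hn x hx, zero_add]
    refine h1.trans_eq ?_
    simp only [Finset.mul_sum]
    exact Finset.sum_congr rfl fun i _ => by ring
  have hsum : IntegrableOn
      (fun x => ∑ i, P.rk.b i * (d i x * Laplacian.laplacian (d i) x)) Ω :=
    integrable_finsetSum _ fun i _ => (hint i).const_mul _
  have hsumI : ∫ x in Ω, ∑ i, P.rk.b i * (d i x * Laplacian.laplacian (d i) x)
      = ∑ i, P.rk.b i * ∫ x in Ω, d i x * Laplacian.laplacian (d i) x := by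
    rw [integral_finsetSum _ fun i _ => (hint i).const_mul _]
    simp only [integral_const_mul]
  have hle : ∀ i ∈ Finset.univ, P.rk.b i * ∫ x in Ω, d i x * Laplacian.laplacian (d i) x ≤ 0 :=
    fun i _ => mul_nonpos_of_nonneg_of_nonpos (hstable.1 i) (hneg i)
  have hptn : ∀ x ∈ Ω, 0 ≤ ∑ i, P.rk.b i * (d i x * Laplacian.laplacian (d i) x) := by
    intro x hx
    have h1 := (sq_nonneg _).trans (hpt x hx)
    exact nonneg_of_mul_nonneg_right h1 (by positivity)
  have hnn : 0 ≤ ∑ i, P.rk.b i * ∫ x in Ω, d i x * Laplacian.laplacian (d i) x := by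
    rw [← hsumI]
    exact setIntegral_nonneg hΩ.measurableSet hptn
  -- Stability makes the weighted sum of integrals nonnegative and Green's identity makes each term
  -- nonpositive, so every term is zero.
  have hzero := le_antisymm (Finset.sum_nonpos hle) hnn
  have hstage : ∀ i, 0 < P.rk.b i → ∀ x ∈ Ω, d i x = 0 := by
    intro i hi x hx
    have h1 := (Finset.sum_eq_zero_iff_of_nonpos hle).1 hzero i (Finset.mem_univ i)
    refine eq_zero_of_integral_mul_laplacian_nonneg hD hΩ hb (hreg i) (h0 i) (hC i) (hΔ i) ?_ hx
    exact ((mul_eq_zero.1 h1).resolve_left hi.ne').ge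
  refine ⟨fun x hx => ?_, hstage⟩
  have h1 := hpt x hx
  -- Nothing is claimed about `dᵢ` when `bᵢ = 0`, but such stages do not enter the sum.
  have h2 : ∑ i, P.rk.b i * (d i x * Laplacian.laplacian (d i) x) = 0 := by
    refine Finset.sum_eq_zero fun i _ => ?_
    rcases (hstable.1 i).eq_or_lt with hi | hi
    · rw [← hi, zero_mul]
    · rw [hstage i hi x hx, zero_mul, mul_zero]
  rw [h2, mul_zero] at h1
  exact pow_eq_zero_iff two_ne_zero |>.1 (le_antisymm h1 (sq_nonneg _))

/-! ### The normal component on the boundary -/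

theorem IsGePUPESRK.tendsto_explicitTerm (hT : IsGePUPESRK Ω P T) (n : ℕ) (i : Fin s)
    {x : Vec D} (hx : x ∈ closure Ω) :
    ∃ L, Tendsto (T.explicitTerm P n i) (𝓝[Ω] x) (𝓝 L) := by
  obtain ⟨a, ha⟩ := (hT.force_reg n i).tendsto hx
  obtain ⟨b, hb⟩ := (hT.uTilde_reg n i).tendsto_conv one_le_two hx
  exact ⟨_, ha.sub (hb.const_smul (T.rStage n i))⟩

/-- The Neumann condition for `q` cancels the forcing, convection and viscous terms in the normal
direction, leaving only the penalty. -/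
theorem IsGePUPESRK.exists_tendsto_rho (hT : IsGePUPESRK Ω P T) (n : ℕ) (i : Fin s)
    {x ν : Vec D} (hν : IsOutwardNormal Ω x ν) :
    ∃ L, Tendsto (T.rho P n i) (𝓝[Ω] x) (𝓝 L) ∧
      ⟪ν, L⟫ = -P.lam * ⟪ν, bdryVal Ω (T.wStage n i) x⟫ := by
  have hx := frontier_subset_closure hν.1
  obtain ⟨a, ha⟩ := hT.tendsto_explicitTerm n i hx
  obtain ⟨b, hb⟩ := (hT.qStage_reg n i).tendsto_gradient one_le_two hx
  obtain ⟨c, hc⟩ := (hT.wStage_reg n i).tendsto_laplacian (by norm_num) hx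
  refine ⟨_, (ha.sub hb).add (hc.const_smul P.ν), ?_⟩
  have h := hT.q_neumann n i x ν hν
  have h1 : bdryVal Ω (gradient (T.qStage n i)) x = b := extendFrom_eq hx hb
  have h2 : bdryVal Ω (fun y => T.explicitTerm P n i y +
      P.ν • Laplacian.laplacian (T.wStage n i) y) x = a + P.ν • c :=
    extendFrom_eq hx (ha.add (hc.const_smul P.ν))
  rw [h1, h2] at h
  simp only [inner_add_right, inner_sub_right] at h ⊢
  linarith

theorem IsGePUPESRK.inner_bdryVal_add_smul_sum_rho (hT : IsGePUPESRK Ω P T)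
    (n : ℕ) (c : Fin s → ℝ) {v : Vec D → Vec D}
    (hv : ∀ x ∈ Ω, v x = T.w n x + P.k • ∑ i, c i • T.rho P n i x)
    {x ν : Vec D} (hν : IsOutwardNormal Ω x ν) :
    ⟪ν, bdryVal Ω v x⟫ = ⟪ν, bdryVal Ω (T.w n) x⟫ +
      P.k * ∑ i, c i * (-P.lam * ⟪ν, bdryVal Ω (T.wStage n i) x⟫) := by
  have hx := frontier_subset_closure hν.1
  choose L hL hLν using fun i => hT.exists_tendsto_rho n i hν
  have hw := tendsto_bdryVal hx ((hT.w_reg n).tendsto hx)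
  have h1 : bdryVal Ω v x = bdryVal Ω (T.w n) x + P.k • ∑ i, c i • L i := by
    rw [bdryVal_congr hv]
    exact extendFrom_eq hx (hw.add ((tendsto_finsetSum _ fun i _ =>
      (hL i).const_smul (c i)).const_smul P.k))
  simp only [h1, inner_add_right, real_inner_smul_right, inner_sum, hLν]

/-- One step of the scheme preserves `n·w = 0` on the boundary, and the stages with positive
weights have zero normal component. -/
theorem IsGePUPESRK.hasZeroNormal_step (hT : IsGePUPESRK Ω P T)
    (hstable : P.rk.AlgebraicallyStable) (n : ℕ) (hn : HasZeroNormal Ω (T.w n)) :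
    HasZeroNormal Ω (T.w (n + 1)) ∧
      ∀ i, 0 < P.rk.b i → HasZeroNormal Ω (T.wStage n i) := by
  have key : ∀ x ν, IsOutwardNormal Ω x ν → ⟪ν, bdryVal Ω (T.w (n + 1)) x⟫ = 0 ∧
      ∀ i, 0 < P.rk.b i → ⟪ν, bdryVal Ω (T.wStage n i) x⟫ = 0 := by
    intro x ν hν
    set Z : Fin s → ℝ := fun i => ⟪ν, bdryVal Ω (T.wStage n i) x⟫ with hZ
    have hstep := hT.inner_bdryVal_add_smul_sum_rho n P.rk.b (hT.w_step n) hν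
    rw [hn x ν hν, zero_add] at hstep
    have hstage : ∀ i, Z i = P.k * ∑ j, P.rk.A i j * (-P.lam * Z j) := by
      intro i
      have h := hT.inner_bdryVal_add_smul_sum_rho n (P.rk.A i) (hT.w_stage n i) hν
      rwa [hn x ν hν, zero_add] at h
    -- Without penalty the slopes are zero, so the normal components keep their initial value `0`.
    -- The energy argument below needs `λ > 0` to recover `Z i = 0` from `bᵢ λ (Z i)² = 0`.
    rcases P.lam_nonneg.eq_or_lt with hl | hl
    · rw [← hl] at hstep hstage
      exact ⟨by simpa using hstep, fun i _ => by simpa [hZ] using hstage i⟩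
    have hk := P.k_pos
    have hsq := hstable.sq_le P.k Z (fun i => -P.lam * Z i) hstage
    have hterm : ∀ i ∈ Finset.univ, P.rk.b i * (Z i * (-P.lam * Z i)) ≤ 0 := fun i _ => by
      have := mul_nonneg (hstable.1 i) (mul_nonneg hl.le (sq_nonneg (Z i)))
      nlinarith
    have hsum : ∑ i, P.rk.b i * (Z i * (-P.lam * Z i)) = 0 :=
      le_antisymm (Finset.sum_nonpos hterm)
        (nonneg_of_mul_nonneg_right ((sq_nonneg _).trans hsq) (by positivity))
    refine ⟨?_, fun i hi => ?_⟩
    · rw [hsum, mul_zero, ← hstep] at hsq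
      exact pow_eq_zero_iff two_ne_zero |>.1 (le_antisymm hsq (sq_nonneg _))
    · have h1 := (Finset.sum_eq_zero_iff_of_nonpos hterm).1 hsum i (Finset.mem_univ i)
      simpa [hi.ne', hl.ne'] using h1
  exact ⟨fun x ν hν => (key x ν hν).1, fun i hi x ν hν => (key x ν hν).2 i hi⟩

end

end GePUP

theorem mainTheorem8 {D s : ℕ} (Ω : Set (GePUP.Vec D)) (hΩ : GePUP.IsFlowDomain Ω)
    (P : GePUP.Params D s) (hstable : P.rk.AlgebraicallyStable)
    (T : GePUP.Trajectory D s) (hT : GePUP.IsGePUPESRK Ω P T)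
    -- the initial velocity is solenoidal and has zero normal component
    (hu_div : ∀ x ∈ Ω, GePUP.divg (T.u 0) x = 0)
    (hu_normal : GePUP.HasZeroNormal Ω (T.u 0))
    -- the initial value of `w` is the initial velocity
    (hinit : ∀ x ∈ Ω, T.w 0 x = T.u 0 x) :
    (∀ n : ℕ,
      eLpNorm (GePUP.divg (T.w n)) 2 (volume.restrict Ω) = 0 ∧
      (∀ x ∈ Ω, GePUP.divg (T.w n) x = 0) ∧
      GePUP.HasZeroNormal Ω (T.w n)) ∧
    (∀ (n : ℕ) (i : Fin s), 0 < P.rk.b i →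
      (∀ x ∈ Ω, GePUP.divg (T.wStage n i) x = 0) ∧
      GePUP.HasZeroNormal Ω (T.wStage n i)) := by
  have hdiv : ∀ n, ∀ x ∈ Ω, GePUP.divg (T.w n) x = 0 := by
    intro n
    induction n with
    | zero => exact fun x hx => (GePUP.divg_congr hΩ.isOpen hinit hx).trans (hu_div x hx)
    | succ n ih => exact (hT.divg_step hΩ.isOpen hΩ.isBounded hstable n ih).1
  have hnormal : ∀ n, GePUP.HasZeroNormal Ω (T.w n) := by
    intro n
    induction n with
    | zero =>
      intro x ν hν
      rw [GePUP.bdryVal_congr hinit]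
      exact hu_normal x ν hν
    | succ n ih => exact (hT.hasZeroNormal_step hstable n ih).1
  refine ⟨fun n => ⟨?_, hdiv n, hnormal n⟩, fun n i hi =>
    ⟨(hT.divg_step hΩ.isOpen hΩ.isBounded hstable n (hdiv n)).2 i hi,
      (hT.hasZeroNormal_step hstable n (hnormal n)).2 i hi⟩⟩
  have h : GePUP.divg (T.w n) =ᵐ[volume.restrict Ω] 0 := by
    filter_upwards [ae_restrict_mem hΩ.isOpen.measurableSet] with x hx using hdiv n x hx
  rw [eLpNorm_congr_ae h, eLpNorm_zero]
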